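/- **Theorem 1.1.** Let $X$ be a compactum, i.e. a compact metrizable space, and let $K(X)$ be the space of compact subsets of $X$ with the Vietoris topology. Call a Borel measure on $X$ (with values in $[0,\infty]$) *semifinite* if each Borel set of positive measure contains a Borel set of finite positive measure, and *non-atomic* if it vanishes on all singletons (for semifinite Borel measures on $X$ this is equivalent to the absence of atoms). A $G_{\delta\sigma}$-set is a countable union of $G_\delta$-sets. Let $\mu$ be a non-atomic semifinite Borel measure on $X$ such that the collection $\{K\in K(X):\mu(K)=0\}$ of compact $\mu$-null sets is coanalytic in $K(X)$. If $\mu$ is not $\sigma$-finite, then there is a $G_{\delta\sigma}$-set $M$ in $X$ such that: (i) $\mu(G\setminus M)>0$ for every $G_\delta$-set $G$ in $X$ containing $M$; (ii) there is a semifinite Borel measure $\mu'\ll\mu$ on $X$ such that $\mu'(M)=0$ but $M$ is not contained in any $\mu'$-null $G_\delta$-set in $X$. -/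

import Mathlib

open MeasureTheory TopologicalSpace

/-- A set is coanalytic if its complement is analytic. -/
def IsCoanalytic {Y : Type*} [TopologicalSpace Y] (s : Set Y) : Prop :=
  AnalyticSet sᶜ

/-- A `G_δσ`-set: a union of countably many `G_δ`-sets. -/
def IsGdeltaSigma {X : Type*} [TopologicalSpace X] (s : Set X) : Prop :=
  ∃ f : ℕ → Set X, (∀ n, IsGδ (f n)) ∧ s = ⋃ n, f n

/-- A measure is semifinite if each measurable set of positive measure contains a measurable set
of finite positive measure. -/
def IsSemifinite {X : Type*} [MeasurableSpace X] (μ : Measure X) : Prop :=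
  ∀ A : Set X, MeasurableSet A → 0 < μ A →
    ∃ B : Set X, B ⊆ A ∧ MeasurableSet B ∧ 0 < μ B ∧ μ B < ⊤

open Set Filter Topology CantorScheme ENNReal

/-! By maximality, a semifinite measure that is not `σ`-finite has uncountably many disjoint compact
sets of positive measure. Such compact sets form a continuous image of Baire space and disjointness
is open, so a Cantor scheme yields a continuous disjoint family `φ x`, with `x` in the Cantor space
(`IsSemifinite.exists_continuous_disjoint`).

The same `x` code all `G_δ`-sets `U x`. A point of `φ x` outside `U x` misses the `n`-th coded open
set for some `n`; for each `n` these points form a compact relation, uniformized by a `G_δ`-set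
(`IsCompact.exists_isGδ_selection`). The union `M` of these selections is countable on each `φ x`,
and `M ⊆ U x` forces `φ x ⊆ U x`. Summing the restrictions of `μ` to finite pieces of `φ x ∩ U x`
gives `μ'`. -/

/-! ### Perfect cliques of open relations -/

theorem Set.not_countable_condensationPoints {α : Type*} [TopologicalSpace α]
    [SecondCountableTopology α] {S : Set α} (hS : ¬ S.Countable) :
    ¬ {x ∈ S | ∀ U ∈ 𝓝 x, ¬ (U ∩ S).Countable}.Countable := by
  intro h
  have hbad : (⋃ b ∈ {b ∈ countableBasis α | (b ∩ S).Countable}, b ∩ S).Countable :=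
    Countable.biUnion ((countable_countableBasis α).mono fun _ hb => hb.1) fun _ hb => hb.2
  refine hS ((h.union hbad).mono fun x hx => ?_)
  by_cases hc : ∀ U ∈ 𝓝 x, ¬ (U ∩ S).Countable
  · exact Or.inl ⟨hx, hc⟩
  · push Not at hc
    obtain ⟨U, hU, hUS⟩ := hc
    obtain ⟨b, hb, hxb, hbU⟩ := (isBasis_countableBasis α).mem_nhds_iff.1 hU
    exact Or.inr (mem_biUnion (show b ∈ {b ∈ countableBasis α | (b ∩ S).Countable} from
      ⟨hb, hUS.mono (inter_subset_inter_left _ hbU)⟩) ⟨hxb, hx⟩)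

/-- An uncountable clique of an open relation can be split, inside a closed set, into two
uncountable parts contained in small closed sets which are completely related to each other. -/
theorem IsOpen.exists_closed_clique_splitting {α : Type*} [MetricSpace α]
    [SecondCountableTopology α] {R : Set (α × α)} (hR : IsOpen R) {C A : Set α}
    (hC : C.Pairwise fun a b => (a, b) ∈ R) (hA : IsClosed A) (hAC : ¬ (A ∩ C).Countable)
    {ε : ℝ≥0∞} (hε : 0 < ε) :
    ∃ A₀ A₁ : Set α, (IsClosed A₀ ∧ ¬ (A₀ ∩ C).Countable ∧ A₀ ⊆ A ∧ Metric.ediam A₀ ≤ ε) ∧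
      (IsClosed A₁ ∧ ¬ (A₁ ∩ C).Countable ∧ A₁ ⊆ A ∧ Metric.ediam A₁ ≤ ε) ∧ A₀ ×ˢ A₁ ⊆ R := by
  have hcond := not_countable_condensationPoints hAC
  have hnt := not_subsingleton_iff.1 fun h => hcond h.countable
  obtain ⟨c, ⟨hcA, hc⟩, d, ⟨hdA, hd⟩, hcd⟩ := hnt
  obtain ⟨U, hU, V, hV, hUV⟩ := mem_nhds_prod_iff.1 (hR.mem_nhds (hC hcA.2 hdA.2 hcd))
  have key : ∀ x : α, ∀ W ∈ 𝓝 x, ∃ B ∈ 𝓝 x, IsClosed B ∧ B ⊆ W ∧ Metric.ediam B ≤ ε := by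
    intro x W hW
    have hε2 : 0 < ε / 2 := ENNReal.div_pos_iff.2 ⟨hε.ne', by simp⟩
    obtain ⟨B, hB, hBc, hBW⟩ := exists_mem_nhds_isClosed_subset
      (inter_mem hW (Metric.eball_mem_nhds x hε2))
    refine ⟨B, hB, hBc, hBW.trans inter_subset_left, ?_⟩
    refine (Metric.ediam_mono (hBW.trans inter_subset_right)).trans ?_
    refine Metric.ediam_eball_le.trans ?_
    rw [mul_comm, ENNReal.div_mul_cancel] <;> norm_num
  obtain ⟨B, hB, hBc, hBU, hBd⟩ := key c U hU
  obtain ⟨D, hD, hDc, hDV, hDd⟩ := key d V hV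
  refine ⟨A ∩ B, A ∩ D, ⟨hA.inter hBc, ?_, inter_subset_left,
    (Metric.ediam_mono inter_subset_right).trans hBd⟩, ⟨hA.inter hDc, ?_, inter_subset_left,
    (Metric.ediam_mono inter_subset_right).trans hDd⟩, fun p hp => hUV ⟨hBU hp.1.2, hDV hp.2.2⟩⟩
  · have := hc B hB
    rwa [← inter_assoc, inter_comm B A] at this
  · have := hd D hD
    rwa [← inter_assoc, inter_comm D A] at this

/-- An open symmetric relation on a Polish space with an uncountable clique has a clique
parametrized continuously by the Cantor space. -/
theorem IsOpen.exists_continuous_clique {α : Type*} [TopologicalSpace α] [PolishSpace α]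
    {R : Set (α × α)} (hR : IsOpen R) (hsymm : ∀ a b, (a, b) ∈ R → (b, a) ∈ R) {C : Set α}
    (hC : C.Pairwise fun a b => (a, b) ∈ R) (hunc : ¬ C.Countable) :
    ∃ g : (ℕ → Bool) → α, Continuous g ∧ Pairwise fun x y => (g x, g y) ∈ R := by
  let := TopologicalSpace.upgradeIsCompletelyMetrizable α
  obtain ⟨u, -, upos', hu⟩ := exists_seq_strictAnti_tendsto' (zero_lt_one' ℝ≥0∞)
  have upos := fun n => (upos' n).1
  let P := Subtype fun E : Set α => IsClosed E ∧ ¬ (E ∩ C).Countable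
  choose C0 C1 h0 h1 hsub using
    fun {A : Set α} (hA : IsClosed A) (hAC : ¬ (A ∩ C).Countable) {ε : ℝ≥0∞} (hε : 0 < ε) =>
    hR.exists_closed_clique_splitting hC hA hAC hε
  let DP : List Bool → P := fun l => by
    induction l with
    | nil => exact ⟨univ, isClosed_univ, by rwa [univ_inter]⟩
    | cons a l ih =>
      cases a
      · use C0 ih.property.1 ih.property.2 (upos (l.length + 1))
        exact ⟨(h0 _ _ _).1, (h0 _ _ _).2.1⟩
      use C1 ih.property.1 ih.property.2 (upos (l.length + 1))
      exact ⟨(h1 _ _ _).1, (h1 _ _ _).2.1⟩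
  let D : List Bool → Set α := fun l => (DP l).val
  have hanti : ClosureAntitone D := by
    refine Antitone.closureAntitone ?_ fun l => (DP l).property.1
    intro l a
    cases a
    · exact (h0 _ _ _).2.2.1
    exact (h1 _ _ _).2.2.1
  have hdiam : VanishingDiam D := by
    intro x
    apply tendsto_of_tendsto_of_tendsto_of_le_of_le' tendsto_const_nhds hu
    · simp
    rw [eventually_atTop]
    refine ⟨1, fun m (hm : 1 ≤ m) => ?_⟩
    rw [Nat.one_le_iff_ne_zero] at hm
    rcases Nat.exists_eq_succ_of_ne_zero hm with ⟨n, rfl⟩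
    dsimp
    cases x n
    · convert! (h0 _ _ _).2.2.2
      rw [PiNat.res_length]
    convert! (h1 _ _ _).2.2.2
    rw [PiNat.res_length]
  have hrel : ∀ l, D (false :: l) ×ˢ D (true :: l) ⊆ R := fun l => hsub _ _ _
  have hne : ∀ l, (D l).Nonempty := by
    intro l
    by_contra h
    rw [not_nonempty_iff_eq_empty] at h
    apply (DP l).property.2
    change (D l ∩ C).Countable
    simp [h]
  have hdom : ∀ {x : ℕ → Bool}, x ∈ (inducedMap D).1 := fun {x} => by
    rw [hanti.map_of_vanishingDiam hdiam hne]
    apply mem_univ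
  refine ⟨fun x => (inducedMap D).2 ⟨x, hdom⟩, ?_, ?_⟩
  · apply hdiam.map_continuous.comp
    fun_prop
  intro x y hxy
  -- Up to their first difference both branches share a stem, so the two values lie in sibling sets;
  -- symmetry covers either order.
  have hres : PiNat.res x (PiNat.firstDiff x y) = PiNat.res y (PiNat.firstDiff x y) :=
    PiNat.res_eq_res.2 fun _ h => PiNat.apply_eq_of_lt_firstDiff h
  have hx := map_mem (A := D) ⟨x, hdom⟩ (PiNat.firstDiff x y + 1)
  have hy := map_mem (A := D) ⟨y, hdom⟩ (PiNat.firstDiff x y + 1)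
  have hdiff := PiNat.apply_firstDiff_ne hxy
  simp only [PiNat.res_succ] at hx hy
  rw [← hres] at hy
  cases hxv : x (PiNat.firstDiff x y) <;> cases hyv : y (PiNat.firstDiff x y) <;>
    rw [hxv] at hx hdiff <;> rw [hyv] at hy hdiff
  · exact absurd rfl hdiff
  · exact hrel _ ⟨hx, hy⟩
  · exact hsymm _ _ (hrel _ ⟨hy, hx⟩)
  · exact absurd rfl hdiff

/-! ### Uniformization by lexicographic minima -/

/-- A nonempty compact set has a point which is lexicographically minimal with respect to a
sequence of continuous functions. -/
theorem IsCompact.exists_lex_minimal {X : Type*} [TopologicalSpace X] [T2Space X] {K : Set X}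
    (hK : IsCompact K) (hne : K.Nonempty) {h : ℕ → X → ℝ} (hh : ∀ j, Continuous (h j)) :
    ∃ z ∈ K, ∀ w ∈ K, ∀ j, (∀ i < j, h i w = h i z) → h j z ≤ h j w := by
  let L : ℕ → Set X := fun n => Nat.rec K (fun j A => {z ∈ A | ∀ w ∈ A, h j z ≤ h j w}) n
  have hLs : ∀ j, L (j + 1) = {z ∈ L j | ∀ w ∈ L j, h j z ≤ h j w} := fun j => rfl
  have hL : ∀ n, IsCompact (L n) ∧ (L n).Nonempty := by
    intro n
    induction n with
    | zero => exact ⟨hK, hne⟩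
    | succ j ih =>
      rw [hLs]
      obtain ⟨z, hz, hmin⟩ := ih.1.exists_isMinOn ih.2 (hh j).continuousOn
      refine ⟨?_, z, hz, fun w hw => hmin hw⟩
      have : {z ∈ L j | ∀ w ∈ L j, h j z ≤ h j w} = L j ∩ ⋂ w ∈ L j, {z | h j z ≤ h j w} := by
        ext; simp
      rw [this]
      exact ih.1.inter_right
        (isClosed_biInter fun w _ => isClosed_le (hh j) continuous_const)
  have hanti : ∀ n, L (n + 1) ⊆ L n := fun n z hz => hz.1
  obtain ⟨z, hz⟩ := IsCompact.nonempty_iInter_of_sequence_nonempty_isCompact_isClosed L hanti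
    (fun n => (hL n).2) (hL 0).1 fun n => (hL n).1.isClosed
  rw [mem_iInter] at hz
  refine ⟨z, hz 0, fun w hw j hj => (hz (j + 1)).2 w ?_⟩
  suffices ∀ i ≤ j, w ∈ L i from this j le_rfl
  intro i
  induction i with
  | zero => exact fun _ => hw
  | succ i ih =>
    intro hi
    have hwi := ih (by omega)
    refine ⟨hwi, fun v hv => ?_⟩
    rw [hj i (by omega)]
    exact (hz (i + 1)).2 v hv

/-- In a metrizable separable space a sequence of continuous functions separates points. -/
theorem exists_continuous_seq_separating (X : Type*) [TopologicalSpace X] [MetrizableSpace X]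
    [SeparableSpace X] :
    ∃ h : ℕ → X → ℝ, (∀ j, Continuous (h j)) ∧ ∀ z w, (∀ j, h j z = h j w) → z = w := by
  let := metrizableSpaceMetric X
  rcases isEmpty_or_nonempty X with hX | hX
  · exact ⟨fun _ _ => 0, fun _ => continuous_const, fun z => hX.elim z⟩
  refine ⟨fun j z => dist z (denseSeq X j), fun j => by fun_prop, fun z w hzw => ?_⟩
  have : (fun d => dist z d) = fun d => dist w d :=
    Continuous.ext_on (denseRange_denseSeq X) (by fun_prop) (by fun_prop)
      (by rintro _ ⟨j, rfl⟩; exact hzw j)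
  have h0 := congrFun this w
  simpa using h0

/-- A compact relation with pairwise disjoint fibres has a uniformization with `G_δ` range. -/
theorem IsCompact.exists_isGδ_selection {Y X : Type*} [TopologicalSpace Y] [T2Space Y]
    [TopologicalSpace X] [CompactSpace X] [MetrizableSpace X] {Γ : Set (Y × X)} (hΓ : IsCompact Γ)
    (hdisj : ∀ x y z, (x, z) ∈ Γ → (y, z) ∈ Γ → x = y) :
    ∃ S : Set X, IsGδ S ∧ (∀ x z, (x, z) ∈ Γ → ∃ w ∈ S, (x, w) ∈ Γ) ∧
      (∀ z ∈ S, ∃ x, (x, z) ∈ Γ) ∧ ∀ x, {z ∈ S | (x, z) ∈ Γ}.Subsingleton := by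
  obtain ⟨h, hh, hsep⟩ := exists_continuous_seq_separating X
  -- Here `w` beats `z` lexicographically at place `j`, by a margin `1 / (n + 1)` that keeps the
  -- condition closed. Hence the non-minimal points form a `σ`-compact set `N`.
  let Q : ℕ → ℕ → Set ((Y × X) × (Y × X)) := fun j n =>
    (Γ ×ˢ Γ) ∩ {p | p.1.1 = p.2.1 ∧ (∀ i < j, h i p.2.2 = h i p.1.2) ∧
      h j p.2.2 + 1 / ((n : ℝ) + 1) ≤ h j p.1.2}
  have hQ : ∀ j n, IsCompact (Q j n) := by
    intro j n
    refine (hΓ.prod hΓ).inter_right ?_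
    have h1 : ∀ i, Continuous fun p : (Y × X) × (Y × X) => h i p.1.2 :=
      fun i => (hh i).comp (by fun_prop)
    have h2 : ∀ i, Continuous fun p : (Y × X) × (Y × X) => h i p.2.2 :=
      fun i => (hh i).comp (by fun_prop)
    refine (isClosed_eq (by fun_prop) (by fun_prop)).inter (IsClosed.inter ?_ ?_)
    · have : {p : (Y × X) × (Y × X) | ∀ i < j, h i p.2.2 = h i p.1.2} =
          ⋂ i, ⋂ (_ : i < j), {p | h i p.2.2 = h i p.1.2} := by ext; simp
      change IsClosed {p : (Y × X) × (Y × X) | ∀ i < j, h i p.2.2 = h i p.1.2}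
      rw [this]
      exact isClosed_iInter fun i => isClosed_iInter fun _ => isClosed_eq (h2 i) (h1 i)
    · exact isClosed_le ((h2 j).add continuous_const) (h1 j)
  let N : Set X := ⋃ j, ⋃ n, (fun p : (Y × X) × (Y × X) => p.1.2) '' Q j n
  have hN : IsGδ Nᶜ := by
    simp only [N, compl_iUnion]
    refine IsGδ.iInter fun j => IsGδ.iInter fun n => IsOpen.isGδ ?_
    exact ((hQ j n).image (by fun_prop)).isClosed.isOpen_compl
  have hmem : ∀ z, z ∈ Nᶜ ↔ ∀ x w, (x, z) ∈ Γ → (x, w) ∈ Γ → ∀ j, (∀ i < j, h i w = h i z) →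
      h j z ≤ h j w := by
    intro z
    constructor
    · intro hz x w hxz hxw j hj
      by_contra! hlt
      obtain ⟨n, hn⟩ := exists_nat_one_div_lt (sub_pos.2 hlt)
      refine hz (mem_iUnion₂.2 ⟨j, n, ((x, z), (x, w)), ⟨⟨hxz, hxw⟩, rfl, hj, ?_⟩, rfl⟩)
      dsimp only
      linarith
    · intro hz hzN
      obtain ⟨j, n, ⟨⟨x, z'⟩, ⟨y, w⟩⟩, ⟨⟨hxz, hxw⟩, hxy, hj, hle⟩, hzz⟩ := mem_iUnion₂.1 hzN
      dsimp only at hxz hxw hxy hj hle hzz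
      subst hxy hzz
      have := hz x w hxz hxw j hj
      have hpos : (0 : ℝ) < 1 / ((n : ℝ) + 1) := by positivity
      linarith
  refine ⟨Prod.snd '' Γ ∩ Nᶜ, IsGδ.inter ?_ hN, ?_, ?_, ?_⟩
  · let := metrizableSpaceMetric X
    exact (hΓ.image continuous_snd).isClosed.isGδ
  · intro x z hxz
    have hfib : IsCompact {w | (x, w) ∈ Γ} :=
      (hΓ.isClosed.preimage (Continuous.prodMk_right x)).isCompact
    obtain ⟨w, hw, hmin⟩ := hfib.exists_lex_minimal ⟨z, hxz⟩ hh
    refine ⟨w, ⟨⟨_, hw, rfl⟩, (hmem w).2 fun y v hy hv => ?_⟩, hw⟩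
    -- Avoiding `N` demands minimality in every fibre through `w`; disjointness leaves only one.
    obtain rfl := hdisj _ _ _ hw hy
    exact hmin v hv
  · rintro z ⟨⟨⟨x, z'⟩, hxz, rfl⟩, -⟩
    exact ⟨x, hxz⟩
  · rintro x z ⟨⟨-, hz⟩, hxz⟩ w ⟨⟨-, hw⟩, hxw⟩
    rw [hmem] at hz hw
    refine hsep z w fun j => ?_
    induction j using Nat.strong_induction_on with
    | _ j ih =>
      exact le_antisymm (hz x w hxz hxw j fun i hi => (ih i hi).symm) (hw x z hxw hxz j ih)

/-! ### Disjoint compact sets of positive measure -/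

theorem IsSemifinite.exists_isCompact {X : Type*} [TopologicalSpace X] [CompactSpace X]
    [MetrizableSpace X] [MeasurableSpace X] [BorelSpace X] {μ : Measure X} (hμ : IsSemifinite μ)
    {A : Set X} (hA : MeasurableSet A) (hpos : 0 < μ A) :
    ∃ K ⊆ A, IsCompact K ∧ 0 < μ K ∧ μ K < ⊤ := by
  obtain ⟨B, hBA, hB, hB0, hBtop⟩ := hμ A hA hpos
  let := metrizableSpaceMetric X
  have : IsFiniteMeasure (μ.restrict B) := ⟨by simpa using hBtop⟩
  have hBB : μ.restrict B B = μ B := by simp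
  obtain ⟨K, hKB, hK, hK0⟩ := hB.exists_lt_isClosed_of_ne_top (μ := μ.restrict B)
    (by rw [hBB]; exact hBtop.ne) (hBB ▸ hB0)
  rw [Measure.restrict_eq_self _ hKB] at hK0
  exact ⟨K, hKB.trans hBA, hK.isCompact, hK0, (measure_mono hKB).trans_lt hBtop⟩

/-- A semifinite measure on a compact metrizable space which is not `σ`-finite admits uncountably
many pairwise disjoint compact sets of positive measure. -/
theorem IsSemifinite.exists_not_countable_disjoint {X : Type*} [TopologicalSpace X]
    [CompactSpace X] [MetrizableSpace X] [MeasurableSpace X] [BorelSpace X] {μ : Measure X}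
    (hμ : IsSemifinite μ) (hσ : ¬ SigmaFinite μ) :
    ∃ F : Set (Compacts X), (∀ K ∈ F, 0 < μ (K : Set X)) ∧
      F.Pairwise (fun K L => Disjoint (K : Set X) (L : Set X)) ∧ ¬ F.Countable := by
  let 𝓕 : Set (Set (Compacts X)) := {F | (∀ K ∈ F, 0 < μ (K : Set X) ∧ μ (K : Set X) < ⊤) ∧
    F.Pairwise (fun K L => Disjoint (K : Set X) (L : Set X))}
  obtain ⟨F, hF⟩ : ∃ F, Maximal (· ∈ 𝓕) F := by
    refine zorn_subset 𝓕 fun c hc hchain => ⟨⋃₀ c, ⟨?_, ?_⟩, fun s hs => subset_sUnion_of_mem hs⟩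
    · rintro K ⟨s, hs, hKs⟩
      exact (hc hs).1 K hKs
    · exact (pairwise_sUnion hchain.directedOn).2 fun s hs => (hc hs).2
  refine ⟨F, fun K hK => (hF.prop.1 K hK).1, hF.prop.2, fun hcount => hσ ?_⟩
  have hU : MeasurableSet (⋃ K ∈ F, (K : Set X)) :=
    MeasurableSet.biUnion hcount fun K _ => K.isCompact.measurableSet
  -- Otherwise a compact set of finite positive measure in the complement would enlarge the maximal
  -- family.
  have hnull : μ (⋃ K ∈ F, (K : Set X))ᶜ = 0 := by
    by_contra hne
    obtain ⟨K, hKU, hK, hK0, hKtop⟩ := hμ.exists_isCompact hU.compl (pos_iff_ne_zero.2 hne)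
    have hdisj : ∀ L ∈ F, Disjoint K (L : Set X) := fun L hL =>
      disjoint_left.2 fun z hz hzL => hKU hz (mem_biUnion hL hzL)
    have hins : insert ⟨K, hK⟩ F ∈ 𝓕 := by
      refine ⟨?_, ?_⟩
      · rintro L (rfl | hL)
        · exact ⟨hK0, hKtop⟩
        · exact hF.prop.1 L hL
      · exact hF.prop.2.insert fun L hL _ => ⟨hdisj L hL, (hdisj L hL).symm⟩
    have hKF : (⟨K, hK⟩ : Compacts X) ∈ F :=
      hF.le_of_ge hins (subset_insert _ _) (mem_insert _ _)
    have := hdisj _ hKF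
    rw [Compacts.coe_mk, disjoint_self] at this
    simp [this] at hK0
  refine Measure.sigmaFinite_of_countable ((hcount.image fun K : Compacts X => (K : Set X)).insert
    (⋃ K ∈ F, (K : Set X))ᶜ) ?_ ?_
  · rintro _ (rfl | ⟨K, hK, rfl⟩)
    · rw [hnull]; exact ENNReal.zero_lt_top
    · exact (hF.prop.1 K hK).2
  · rw [sUnion_insert, sUnion_image, compl_union_self]

/-- The sum of the restrictions of a measure to pairwise disjoint sets of finite measure is semifinite. -/
theorem isSemifinite_sum_restrict {X ι : Type*} [MeasurableSpace X] {μ : Measure X}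
    {B : ι → Set X} (hB : ∀ i, MeasurableSet (B i)) (hfin : ∀ i, μ (B i) < ⊤)
    (hdisj : Pairwise fun i j => Disjoint (B i) (B j)) :
    IsSemifinite (Measure.sum fun i => μ.restrict (B i)) := by
  intro A hA hpos
  rw [Measure.sum_apply _ hA, pos_iff_ne_zero, Ne, ENNReal.tsum_eq_zero, not_forall] at hpos
  obtain ⟨i, hi⟩ := hpos
  have hval : (Measure.sum fun i => μ.restrict (B i)) (A ∩ B i) = μ (A ∩ B i) := by
    rw [Measure.sum_apply _ (hA.inter (hB i)), tsum_eq_single i]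
    · rw [Measure.restrict_eq_self _ inter_subset_right]
    · intro j hj
      rw [Measure.restrict_apply (hA.inter (hB i)), inter_assoc, (hdisj hj.symm).inter_eq]
      simp
  refine ⟨A ∩ B i, inter_subset_left, hA.inter (hB i), ?_, ?_⟩
  · rw [hval, ← Measure.restrict_apply hA]
    exact pos_iff_ne_zero.2 hi
  · rw [hval]
    exact (measure_mono inter_subset_right).trans_lt (hfin i)

/-- If the compact null sets of a semifinite measure that is not `σ`-finite form a coanalytic
set, then there is a continuous family, indexed by the Cantor space, of pairwise disjoint compact
sets of positive measure. -/
theorem IsSemifinite.exists_continuous_disjoint {X : Type*} [TopologicalSpace X]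
    [CompactSpace X] [MetrizableSpace X] [MeasurableSpace X] [BorelSpace X] {μ : Measure X}
    (hμ : IsSemifinite μ) (hσ : ¬ SigmaFinite μ)
    (hcoan : IsCoanalytic {K : Compacts X | μ (K : Set X) = 0}) :
    ∃ φ : (ℕ → Bool) → Compacts X, Continuous φ ∧ (∀ x, 0 < μ (φ x : Set X)) ∧
      Pairwise fun x y => Disjoint (φ x : Set X) (φ y : Set X) := by
  obtain ⟨F, hF, hFdisj, hFunc⟩ := hμ.exists_not_countable_disjoint hσ
  have hFsub : F ⊆ {K : Compacts X | μ (K : Set X) = 0}ᶜ := fun K hK => (hF K hK).ne'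
  rw [IsCoanalytic, AnalyticSet] at hcoan
  rcases hcoan with h | ⟨f, hf, hfr⟩
  · rw [h, subset_empty_iff] at hFsub
    exact absurd (hFsub ▸ countable_empty) hFunc
  have hchoose : ∀ K : F, ∃ a, f a = K := fun K => by
    have := hFsub K.2
    rwa [← hfr] at this
  choose a ha using hchoose
  have hopen : IsOpen {p : (ℕ → ℕ) × (ℕ → ℕ) | Disjoint (f p.1 : Set X) (f p.2 : Set X)} :=
    Compacts.isOpen_setOfPred_disjoint_coe.preimage (hf.prodMap hf)
  obtain ⟨g, hg, hgdisj⟩ := hopen.exists_continuous_clique (fun _ _ h => Disjoint.symm h)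
    (C := range a) (by
      rintro _ ⟨K, rfl⟩ _ ⟨L, rfl⟩ hne
      change Disjoint (f (a K) : Set X) (f (a L) : Set X)
      rw [ha, ha]
      refine hFdisj K.2 L.2 fun h => hne ?_
      rw [Subtype.ext h])
    (by
      intro hcount
      refine hFunc ((hcount.image f).mono ?_)
      intro K hK
      exact ⟨a ⟨K, hK⟩, mem_range_self (⟨K, hK⟩ : F), ha ⟨K, hK⟩⟩)
  refine ⟨f ∘ g, hf.comp hg, fun x => pos_iff_ne_zero.2 ?_, hgdisj⟩
  have : f (g x) ∈ {K : Compacts X | μ (K : Set X) = 0}ᶜ := hfr ▸ mem_range_self _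
  exact this

/-! ### Diagonalization against coded `G_δ`-sets -/

theorem TopologicalSpace.Compacts.isClosed_setOf_mem {X : Type*} [TopologicalSpace X] [T2Space X] :
    IsClosed {p : Compacts X × X | p.2 ∈ p.1} := by
  have : {p : Compacts X × X | p.2 ∈ p.1} =
      (fun p : Compacts X × X => (p.1, ({p.2} : Compacts X))) ⁻¹'
      {p : Compacts X × Compacts X | Disjoint (p.1 : Set X) (p.2 : Set X)}ᶜ := by
    ext; simp
  rw [this]
  refine Compacts.isOpen_setOfPred_disjoint_coe.isClosed_compl.preimage ?_
  exact continuous_fst.prodMk (Compacts.continuous_singleton.comp continuous_snd)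

/-- Every `G_δ`-set of a second countable space is coded by a point of the Cantor space. -/
theorem IsGδ.exists_code {X : Type*} [TopologicalSpace X] {b : ℕ → Set X}
    (hb : IsTopologicalBasis (range b)) {G : Set X} (hG : IsGδ G) :
    ∃ x : ℕ → Bool, G = {z | ∀ n, ∃ k, z ∈ b k ∧ x (Nat.pair n k) = true} := by
  classical
  obtain ⟨O, hO, rfl⟩ := isGδ_iff_eq_iInter_nat.1 hG
  refine ⟨fun m => decide (b m.unpair.2 ⊆ O m.unpair.1), ?_⟩
  ext z
  simp only [mem_iInter, mem_ofPred_eq, Nat.unpair_pair, decide_eq_true_eq]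
  refine forall_congr' fun n => ⟨fun hz => ?_, fun ⟨k, hk, hkO⟩ => hkO hk⟩
  obtain ⟨_, ⟨k, rfl⟩, hzk, hkO⟩ := hb.mem_nhds_iff.1 ((hO n).mem_nhds hz)
  exact ⟨k, hzk, hkO⟩

/-- Given a continuous family of pairwise disjoint compact sets indexed by the Cantor space, and
a coding of `G_δ`-sets by points of the Cantor space, there is a `G_δσ`-set with countable traces
on the family that meets each member in a point outside the `G_δ`-set with the same index,
unless the latter contains that member. -/
theorem exists_isGdeltaSigma_diagonal {X : Type*} [TopologicalSpace X] [CompactSpace X]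
    [MetrizableSpace X] {φ : (ℕ → Bool) → Compacts X} (hφ : Continuous φ)
    (hdisj : Pairwise fun x y => Disjoint (φ x : Set X) (φ y : Set X)) {b : ℕ → Set X}
    (hb : ∀ k, IsOpen (b k)) :
    ∃ M : Set X, IsGdeltaSigma M ∧ (∀ x, (M ∩ φ x).Countable) ∧
      ∀ x, ¬ (φ x : Set X) ⊆ {z | ∀ n, ∃ k, z ∈ b k ∧ x (Nat.pair n k) = true} →
        ¬ M ∩ φ x ⊆ {z | ∀ n, ∃ k, z ∈ b k ∧ x (Nat.pair n k) = true} := by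
  -- The fibre of `Γ n` over `x` is the part of `φ x` outside the `n`-th open set coded by `x`
  -- itself.
  let Γ : ℕ → Set ((ℕ → Bool) × X) := fun n =>
    {p | p.2 ∈ φ p.1} ∩ ⋂ k, ({p | p.2 ∈ b k} ∩ {p | p.1 (Nat.pair n k) = true})ᶜ
  have hΓ : ∀ n, IsCompact (Γ n) := fun n => by
    refine (IsClosed.inter ?_ (isClosed_iInter fun k => ?_)).isCompact
    · exact Compacts.isClosed_setOf_mem.preimage ((hφ.comp continuous_fst).prodMk continuous_snd)
    · have hc : Continuous fun p : (ℕ → Bool) × X => p.1 (Nat.pair n k) := by fun_prop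
      exact (((hb k).preimage continuous_snd).inter
        ((isOpen_discrete {true}).preimage hc)).isClosed_compl
  have hΓd : ∀ n x y z, (x, z) ∈ Γ n → (y, z) ∈ Γ n → x = y := fun n x y z hx hy => by
    by_contra hne
    exact disjoint_left.1 (hdisj hne) hx.1 hy.1
  choose S hSδ hSne hSΓ hSsub using fun n => (hΓ n).exists_isGδ_selection (hΓd n)
  refine ⟨⋃ n, S n, ⟨S, hSδ, rfl⟩, fun x => ?_, fun x hx hsub => ?_⟩
  · rw [iUnion_inter]
    refine countable_iUnion fun n => ((hSsub n x).anti fun z hz => ⟨hz.1, ?_⟩).countable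
    obtain ⟨y, hy⟩ := hSΓ n z hz.1
    have hxy : x = y := by
      by_contra hne
      exact disjoint_left.1 (hdisj hne) hz.2 hy.1
    rwa [hxy]
  · obtain ⟨z, hz, hzn⟩ := not_subset.1 hx
    simp only [mem_ofPred_eq, not_forall] at hzn
    obtain ⟨n, hn⟩ := hzn
    obtain ⟨w, hw, hxw⟩ := hSne n x z ⟨hz, mem_iInter.2 fun k hk => hn ⟨k, hk⟩⟩
    obtain ⟨k, hk⟩ := hsub ⟨mem_iUnion.2 ⟨n, hw⟩, hxw.1⟩ n
    exact mem_iInter.1 hxw.2 k hk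

theorem theorem1p1 {X : Type*} [TopologicalSpace X] [CompactSpace X] [MetrizableSpace X]
    [MeasurableSpace X] [BorelSpace X] (μ : Measure X)
    (h_nonatomic : NullSingletonClass μ) (h_semifinite : IsSemifinite μ)
    (h_coanalytic : IsCoanalytic {K : Compacts X | μ (K : Set X) = 0})
    (h_not_sigmaFinite : ¬ SigmaFinite μ) :
    ∃ M : Set X, IsGdeltaSigma M ∧
      (∀ G : Set X, IsGδ G → M ⊆ G → 0 < μ (G \ M)) ∧
      ∃ μ' : Measure X, IsSemifinite μ' ∧ μ' ≪ μ ∧ μ' M = 0 ∧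
        ¬ ∃ G : Set X, IsGδ G ∧ M ⊆ G ∧ μ' G = 0 := by
  obtain ⟨φ, hφ, hφpos, hφdisj⟩ :=
    h_semifinite.exists_continuous_disjoint h_not_sigmaFinite h_coanalytic
  obtain ⟨b, hb⟩ : ∃ b : ℕ → Set X, IsTopologicalBasis (range b) := by
    -- Adding `∅` makes the basis nonempty, hence the range of a sequence.
    obtain ⟨b, hb⟩ := ((countable_countableBasis X).insert ∅).exists_eq_range (insert_nonempty _ _)
    exact ⟨b, hb ▸ (isBasis_countableBasis X).insert_empty⟩
  have hbo : ∀ k, IsOpen (b k) := fun k => hb.isOpen (mem_range_self k)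
  obtain ⟨M, hM, hMc, hMdiag⟩ := exists_isGdeltaSigma_diagonal hφ hφdisj hbo
  let U : (ℕ → Bool) → Set X := fun x => {z | ∀ n, ∃ k, z ∈ b k ∧ x (Nat.pair n k) = true}
  have hU : ∀ x, MeasurableSet (U x) := fun x => by
    have : U x = ⋂ n, ⋃ k, ⋃ (_ : x (Nat.pair n k) = true), b k := by
      ext z; simp [U, and_comm]
    rw [this]
    exact MeasurableSet.iInter fun n => MeasurableSet.iUnion fun k => MeasurableSet.iUnion
      fun _ => (hbo k).measurableSet
  -- Finiteness of `μ B` makes `μ'` semifinite; `B ⊆ U x` lets `μ' (U x) = 0` force `μ B = 0`, hence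
  -- `φ x ∩ U x` null.
  have hBex : ∀ x, ∃ B ⊆ (φ x : Set X) ∩ U x, MeasurableSet B ∧ μ B < ⊤ ∧
      (0 < μ ((φ x : Set X) ∩ U x) → 0 < μ B) := fun x => by
    by_cases hpos : 0 < μ ((φ x : Set X) ∩ U x)
    · obtain ⟨B, hB, hBm, hB0, hBtop⟩ :=
        h_semifinite _ ((φ x).isCompact.measurableSet.inter (hU x)) hpos
      exact ⟨B, hB, hBm, hBtop, fun _ => hB0⟩
    · exact ⟨∅, empty_subset _, .empty, by simp, fun h => absurd h hpos⟩
  choose B hBsub hBm hBtop hBpos using hBex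
  have hMm : MeasurableSet M := by
    obtain ⟨f, hf, rfl⟩ := hM
    exact MeasurableSet.iUnion fun n => (hf n).measurableSet
  have hac : (Measure.sum fun x => μ.restrict (B x)) ≪ μ :=
    Measure.absolutelyContinuous_sum_left fun x => Measure.restrict_le_self.absolutelyContinuous
  have hnull : (Measure.sum fun x => μ.restrict (B x)) M = 0 := by
    rw [Measure.sum_apply _ hMm, ENNReal.tsum_eq_zero]
    intro x
    rw [Measure.restrict_apply hMm]
    exact ((hMc x).mono (inter_subset_inter_right _
      ((hBsub x).trans inter_subset_left))).measure_zero μ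
  have hG : ∀ G : Set X, IsGδ G → M ⊆ G → (Measure.sum fun x => μ.restrict (B x)) G ≠ 0 := by
    intro G hG hMG h0
    obtain ⟨x, rfl⟩ := hG.exists_code hb
    rw [Measure.sum_apply _ (hU x), ENNReal.tsum_eq_zero] at h0
    have hx := h0 x
    rw [Measure.restrict_apply (hU x),
      inter_eq_right.2 ((hBsub x).trans inter_subset_right)] at hx
    have hφU : μ ((φ x : Set X) ∩ U x) = 0 := by
      by_contra hne
      exact (hBpos x (pos_iff_ne_zero.2 hne)).ne' hx
    refine hMdiag x (fun hsub => (hφpos x).ne' ?_) (inter_subset_left.trans hMG)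
    rwa [inter_eq_left.2 hsub] at hφU
  refine ⟨M, hM, fun G hGδ hMG => pos_iff_ne_zero.2 fun h0 => hG G hGδ hMG ?_,
    _, isSemifinite_sum_restrict hBm hBtop ?_, hac, hnull, fun ⟨G, hGδ, hMG, h0⟩ => hG G hGδ hMG h0⟩
  -- Clause (i) follows from (ii): if `μ (G \ M) = 0`, then `μ' ≪ μ` and `μ' M = 0` give `μ' G = 0`.
  · rw [← sdiff_union_of_subset hMG]
    exact measure_union_null (hac h0) hnull
  · exact fun x y hxy => (hφdisj hxy).mono ((hBsub x).trans inter_subset_left)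
      ((hBsub y).trans inter_subset_left)
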